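/- For integers $n\ge 1$ let $\mathrm{iidLP}_{1,n}$ denote the optimal value of the following semi-infinite linear program, which compares the optimal online policy (dynamic program) with the prophet for one slot ($k=1$) and $n$ IID agents: maximize $\theta\in\mathbb{R}$ over real numbers $\theta$ and $(x_i,y_i)_{i=1}^n$ subject to $$\theta\cdot\mathbb{E}\bigl[\min\{\mathrm{Bin}(n,q),1\}\bigr]\;\le\;\sum_{i=1}^n\min\{y_i,\;q\,x_i\}\qquad\text{for all } q\in(0,1],$$ $$x_1=1,\qquad x_i=x_{i-1}-y_{i-1}\ (2\le i\le n),\qquad 0\le y_i\le x_i\ (1\le i\le n),$$ where $\mathrm{Bin}(n,q)$ is a binomial random variable with $n$ trials and success probability $q$. (Here $x_i$ is the probability that the slot is still free when agent $i$ arrives, and $y_i$ is the probability of accepting agent $i$.) **Theorem.** For every $n\ge1$ the maximum defining $\mathrm{iidLP}_{1,n}$ is attained. There is exactly one constant $\theta^*>0$ for which there exists a differentiable function $H:[0,1]\to[0,\infty)$ (one-sided derivatives at the end points, $0\ln 0:=0$) with $$\frac1{\theta^*}-1=H(x)\bigl(\ln H(x)-1\bigr)-H'(x)\quad\text{for all }x\in[0,1],\qquad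 H(0)=1,\quad H(1)=0,$$ and this constant satisfies $0.745<\theta^*<0.746$ and $$\inf_{n\ge1}\mathrm{iidLP}_{1,n}=\lim_{n\to\infty}\mathrm{iidLP}_{1,n}=\theta^*.$$ -/

import Mathlib

open Set Filter Topology MeasureTheory ProbabilityTheory

/-- The state-updating polytope `𝒫ᵏₙ` for `k` slots and `n` agents, with agents `i = 1, …, n` and
slot counts `l = 1, …, k`.  Here `x i l` is the probability that exactly `l` slots remain when agent
`i` arrives, and `y i l` is the probability that agent `i` is accepted in that state; the term
`y i (k + 1)` is understood to be `0`.  Values at other indices are irrelevant. -/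
structure IsStatePath (k n : ℕ) (x y : ℕ → ℕ → ℝ) : Prop where
  /-- Before the first agent all `k` slots are available. -/
  init : ∀ l ∈ Finset.Icc 1 k, x 1 l = if l = k then 1 else 0
  /-- The state probabilities are updated by the acceptance probabilities. -/
  update : ∀ i ∈ Finset.Icc 2 n, ∀ l ∈ Finset.Icc 1 k,
    x i l = x (i - 1) l - y (i - 1) l + (if l = k then 0 else y (i - 1) (l + 1))
  /-- One cannot accept in a state more often than one visits it. -/
  le : ∀ i ∈ Finset.Icc 1 n, ∀ l ∈ Finset.Icc 1 k, y i l ≤ x i l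
  /-- Acceptance probabilities are nonnegative. -/
  nonneg : ∀ i ∈ Finset.Icc 1 n, ∀ l ∈ Finset.Icc 1 k, 0 ≤ y i l

/-- The prophet's coefficient `𝔼[min {Bin(n, q), k}]`. -/
noncomputable def prophetCoeff (k n : ℕ) (q : unitInterval) : ℝ :=
  ∫ j : ℕ, min (j : ℝ) (k : ℝ) ∂(ProbabilityTheory.binomial n q)

/-- The values of `θ` feasible for the semi-infinite linear program comparing the optimal dynamic
program with the prophet, for `k` slots and `n` IID agents: some `(x, y) ∈ 𝒫ᵏₙ` satisfies
`θ · 𝔼[min {Bin(n, q), k}] ≤ ∑ i, ∑ l, min {y i l, q * x i l}` for all `q ∈ (0, 1]`. -/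
def iidFeasible (k n : ℕ) : Set ℝ :=
  {θ | ∃ x y : ℕ → ℕ → ℝ, IsStatePath k n x y ∧
    ∀ q : unitInterval, 0 < q →
      θ * prophetCoeff k n q ≤
        ∑ i ∈ Finset.Icc 1 n, ∑ l ∈ Finset.Icc 1 k, min (y i l) ((q : ℝ) * x i l)}

/-- The optimal value of the semi-infinite linear program: the largest feasible `θ`. -/
noncomputable def iidLP (k n : ℕ) : ℝ := sSup (iidFeasible k n)

/-- `θ` is a positive constant for which the boundary value problem
`1 / θ - 1 = H (ln H - 1) - H'` on `[0, 1]`, `H 0 = 1`, `H 1 = 0`, has a nonnegative solution `H`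
(with one-sided derivatives at the end points, and `0 * ln 0 = 0`, as `Real.log 0 = 0`). -/
def IsLimitConstant (θ : ℝ) : Prop :=
  0 < θ ∧ ∃ H H' : ℝ → ℝ,
    (∀ x ∈ Icc (0 : ℝ) 1, 0 ≤ H x) ∧
    (∀ x ∈ Icc (0 : ℝ) 1, HasDerivWithinAt H (H' x) (Icc 0 1) x) ∧
    (∀ x ∈ Icc (0 : ℝ) 1, 1 / θ - 1 = H x * (Real.log (H x) - 1) - H' x) ∧
    H 0 = 1 ∧ H 1 = 0

/-! Put `c = 1/θ - 1`. The boundary value problem is the autonomous equation `H' = -(c + H - H ln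
H)`. Separating variables, its solution from `1` reaches `0` exactly at time `1` iff `∫₀¹ ds / (c +
s - s ln s) = 1`. This integral is continuous in `c` and lies on opposite sides of `1` at `c =
1/0.746 - 1` and `c = 1/0.745 - 1`. Uniqueness follows because solutions for different `c` can cross
in one direction only.

Every `n = m + 1` admits `θ*`: agent `j + 1` serves the quantile interval `[s (j + 1), s j]`, where
`(m + 1) s (j + 1)^m = max 0 (m s j^(m + 1) - c)`. The prophet's value `1 - p^(m + 1)`, `p = 1 - q`,
splits as an integral over these intervals, and each piece is at most the corresponding term of the
linear program (`mem_iidFeasible_of_recursion`). The policy needs `s` to vanish after `n` steps,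
which holds since `s j^m ≤ H (j / n)` (`rpow_sub_le_descent`).

Conversely, a feasible policy for `θ` forces its remaining free probability after `j` agents to
dominate `θ n v j` for every Euler-type subsolution `v` of the equation with constant `1/θ - 1`
(`le_remainingProb`). If `θ > θ*`, slightly compressing the solution for `θ*` gives such a `v` that
is still positive at the end when `n` is large, whereas nothing remains after the last agent. -/

/-! ### The entropy rate and quadrature bounds for its shifted inverse -/

/-- The function `s ↦ s - s ln s` on `[0, 1]`, extended to the line by constants. -/
noncomputable def entropyRate (s : ℝ) : ℝ :=
  max 0 (min s 1) + Real.negMulLog (max 0 (min s 1))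

lemma entropyRate_eq {s : ℝ} (h0 : 0 ≤ s) (h1 : s ≤ 1) :
    entropyRate s = s - s * Real.log s := by
  unfold entropyRate
  rw [min_eq_left h1, max_eq_right h0, Real.negMulLog]; ring

lemma continuous_entropyRate : Continuous entropyRate := by
  unfold entropyRate
  fun_prop

lemma entropyRate_nonneg (s : ℝ) : 0 ≤ entropyRate s := by
  unfold entropyRate
  have h : max 0 (min s 1) ≤ 1 := by simp
  have := Real.negMulLog_nonneg (le_max_left 0 (min s 1)) h
  have := le_max_left 0 (min s 1)
  linarith

lemma entropyRate_le_one (s : ℝ) : entropyRate s ≤ 1 := by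
  unfold entropyRate
  have := Real.negMulLog_le_one_sub_self (le_max_left 0 (min s 1))
  linarith

lemma concaveOn_entropyRate : ConcaveOn ℝ (Icc 0 1) entropyRate := by
  have h : ConcaveOn ℝ (Icc 0 1) (fun s : ℝ => s + Real.negMulLog s) :=
    (concaveOn_id (convex_Icc 0 1)).add
      (Real.concaveOn_negMulLog.subset (fun x hx => hx.1) (convex_Icc 0 1))
  refine h.congr fun s hs => ?_
  rw [entropyRate_eq hs.1 hs.2]
  simp only [Real.negMulLog]; ring

/-- The tangent at `m` has slope `-ln m`; the bound reduces to `1 + ln (m / s) ≤ m / s`, with `s =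
0` treated apart. -/
lemma entropyRate_le_tangent {s m : ℝ} (hs0 : 0 ≤ s) (hs1 : s ≤ 1) (hm0 : 0 < m) (hm1 : m ≤ 1) :
    entropyRate s ≤ entropyRate m - Real.log m * (s - m) := by
  rw [entropyRate_eq hs0 hs1, entropyRate_eq hm0.le hm1]
  rcases hs0.eq_or_lt with rfl | hs
  · simp; linarith
  · have h := Real.add_one_le_exp (Real.log m - Real.log s)
    rw [Real.exp_sub, Real.exp_log hm0, Real.exp_log hs, le_div_iff₀ hs] at h
    nlinarith

lemma continuous_inv_add_entropyRate {c : ℝ} (hc : 0 < c) :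
    Continuous fun s => (c + entropyRate s)⁻¹ :=
  (continuous_const.add continuous_entropyRate).inv₀ fun s =>
    (add_pos_of_pos_of_nonneg hc (entropyRate_nonneg s)).ne'

/-- The inverse is convex and decreasing on the positive reals, so it turns a positive concave
function into a convex one. Hence the trapezoid rule overestimates the integral. -/
lemma convexOn_inv_add_entropyRate {c : ℝ} (hc : 0 < c) :
    ConvexOn ℝ (Icc 0 1) fun s => (c + entropyRate s)⁻¹ := by
  refine ⟨convex_Icc 0 1, fun x hx y hy a b ha hb hab => ?_⟩
  have h := concaveOn_entropyRate.2 hx hy ha hb hab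
  simp only [smul_eq_mul] at h ⊢
  have hX : 0 < c + entropyRate x := by linarith [entropyRate_nonneg x]
  have hY : 0 < c + entropyRate y := by linarith [entropyRate_nonneg y]
  have h2 := (convexOn_zpow (𝕜 := ℝ) (-1)).2 hX hY ha hb hab
  simp only [smul_eq_mul, zpow_neg_one] at h2
  refine le_trans (inv_anti₀ ?_ ?_) h2
  · exact (convex_Ioi (0 : ℝ)) hX hY ha hb hab
  · nlinarith

lemma integral_affine_about_midpoint (a b A B : ℝ) :
    ∫ x in a..b, (A + B * (x - (a + b) / 2)) = (b - a) * A := by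
  have h : ∀ x ∈ uIcc a b,
      HasDerivAt (fun x : ℝ => A * x + B * (x - (a + b) / 2) ^ 2 / 2)
        (A + B * (x - (a + b) / 2)) x := fun x _ => by
    have h1 := (hasDerivAt_id x).const_mul A
    have h2 := ((((hasDerivAt_id x).sub_const ((a + b) / 2)).pow 2).const_mul B).div_const 2
    refine (h1.add h2).congr_deriv ?_
    simp; ring
  rw [intervalIntegral.integral_eq_sub_of_hasDerivAt h
    (Continuous.intervalIntegrable (by fun_prop) _ _)]
  ring

lemma ConvexOn.integral_le_trapezoid {f : ℝ → ℝ} {a b : ℝ} (hab : a < b)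
    (hf : ConvexOn ℝ (Icc a b) f) (hc : Continuous f) :
    ∫ x in a..b, f x ≤ (b - a) * ((f a + f b) / 2) := by
  rw [← integral_affine_about_midpoint a b _ ((f b - f a) / (b - a))]
  refine intervalIntegral.integral_mono_on hab.le (hc.intervalIntegrable _ _)
    (Continuous.intervalIntegrable (by fun_prop) _ _) fun x hx => ?_
  have hd : 0 < b - a := sub_pos.2 hab
  have h := hf.2 (left_mem_Icc.2 hab.le) (right_mem_Icc.2 hab.le)
    (div_nonneg (sub_nonneg.2 hx.2) hd.le) (div_nonneg (sub_nonneg.2 hx.1) hd.le)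
    (by field_simp; ring)
  simp only [smul_eq_mul] at h
  have e1 : (b - x) / (b - a) * a + (x - a) / (b - a) * b = x := by field_simp; ring
  rw [e1] at h
  refine h.trans (le_of_eq ?_)
  field_simp; ring

lemma integral_inv_add_entropyRate_le {c a b A B : ℝ} (hc : 0 < c) (ha : 0 ≤ a) (hab : a < b)
    (hb : b ≤ 1) (hA0 : 0 ≤ A) (hB0 : 0 ≤ B) (hA : A ≤ entropyRate a) (hB : B ≤ entropyRate b) :
    ∫ s in a..b, (c + entropyRate s)⁻¹ ≤ (b - a) * (((c + A)⁻¹ + (c + B)⁻¹) / 2) := by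
  refine (((convexOn_inv_add_entropyRate hc).subset (Icc_subset_Icc ha hb)
    (convex_Icc a b)).integral_le_trapezoid hab (continuous_inv_add_entropyRate hc)).trans ?_
  have h1 : 0 ≤ b - a := by linarith
  gcongr

/-- This is the midpoint rule: the integrand lies above a line through its midpoint value, and the
linear term integrates to zero. -/
lemma le_integral_inv_add_entropyRate {c a b M : ℝ} (hc : 0 < c) (ha : 0 ≤ a) (hab : a < b)
    (hb : b ≤ 1) (hM : entropyRate ((a + b) / 2) ≤ M) :
    (b - a) * (c + M)⁻¹ ≤ ∫ s in a..b, (c + entropyRate s)⁻¹ := by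
  set m := (a + b) / 2 with hm
  have hX : 0 < c + entropyRate m := by linarith [entropyRate_nonneg m]
  have h1 : (b - a) * (c + M)⁻¹ ≤ (b - a) * (c + entropyRate m)⁻¹ := by
    have h1 : 0 ≤ b - a := by linarith
    gcongr
  refine h1.trans ?_
  rw [← integral_affine_about_midpoint a b _ (Real.log m / (c + entropyRate m) ^ 2)]
  refine intervalIntegral.integral_mono_on hab.le
    (Continuous.intervalIntegrable (by fun_prop) _ _)
    ((continuous_inv_add_entropyRate hc).intervalIntegrable _ _) fun x hx => ?_
  have ht := entropyRate_le_tangent (s := x) (m := m) (by linarith [hx.1]) (by linarith [hx.2])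
    (by rw [hm]; linarith) (by rw [hm]; linarith)
  have hY : 0 < c + entropyRate x := by linarith [entropyRate_nonneg x]
  rw [← hm]
  set X := c + entropyRate m
  set Y := c + entropyRate x
  have hYX : Y ≤ X - Real.log m * (x - m) := by simp only [X, Y]; linarith
  -- Tangent of `Y ↦ 1 / Y` at `X`; together with the entropy tangent it gives the affine minorant.
  have h3 : 2 / X - Y / X ^ 2 ≤ Y⁻¹ := by
    rw [← sub_nonneg]
    have : Y⁻¹ - (2 / X - Y / X ^ 2) = (X - Y) ^ 2 / (X ^ 2 * Y) := by field_simp; ring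
    rw [this]; positivity
  refine le_trans ?_ h3
  have h4 : Y / X ^ 2 ≤ (X - Real.log m * (x - m)) / X ^ 2 := by gcongr
  have h5 : (X - Real.log m * (x - m)) / X ^ 2 = X⁻¹ - Real.log m / X ^ 2 * (x - m) := by
    field_simp
  have h6 : 2 / X = 2 * X⁻¹ := by ring
  linarith

/-- On a geometric grid all logarithms are multiples of `log r`, so rational bounds for very few
logarithms suffice for the quadrature. -/
lemma entropyRate_pow {r : ℝ} (h0 : 0 < r) (h1 : r ≤ 1) (i : ℕ) :
    entropyRate (r ^ i) = r ^ i * (1 + i * (-Real.log r)) := by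
  rw [entropyRate_eq (by positivity) (pow_le_one₀ h0.le h1), Real.log_pow]; ring

lemma integral_pow_one_le_sum {c r l : ℝ} (hc : 0 < c) (hr0 : 0 < r) (hr1 : r < 1) (hl0 : 0 ≤ l)
    (hl : l ≤ -Real.log r) (N : ℕ) :
    ∫ s in (r ^ N)..1, (c + entropyRate s)⁻¹ ≤ ∑ i ∈ Finset.range N,
      (r ^ i - r ^ (i + 1)) * (((c + r ^ (i + 1) * (1 + (i + 1 : ℕ) * l))⁻¹ +
        (c + r ^ i * (1 + i * l))⁻¹) / 2) := by
  have hint : ∀ a b : ℝ, IntervalIntegrable (fun s => (c + entropyRate s)⁻¹) volume a b :=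
    fun a b => (continuous_inv_add_entropyRate hc).intervalIntegrable _ _
  have hG : ∀ i : ℕ, r ^ i * (1 + i * l) ≤ entropyRate (r ^ i) := fun i => by
    rw [entropyRate_pow hr0 hr1.le]; gcongr
  induction N with
  | zero => simp
  | succ N ih =>
    rw [Finset.sum_range_succ, ← intervalIntegral.integral_add_adjacent_intervals
      (hint (r ^ (N + 1)) (r ^ N)) (hint _ _), add_comm]
    refine add_le_add ih ?_
    exact integral_inv_add_entropyRate_le hc (by positivity)
      (pow_lt_pow_right_of_lt_one₀ hr0 hr1 (Nat.lt_succ_self N)) (pow_le_one₀ hr0.le hr1.le)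
      (by positivity) (by positivity) (hG _) (hG _)

lemma sum_le_integral_pow_one {c r l k : ℝ} (hc : 0 < c) (hr0 : 0 < r) (hr1 : r < 1)
    (hl : -Real.log r ≤ l) (hk : -Real.log ((1 + r) / 2) ≤ k) (N : ℕ) :
    ∑ i ∈ Finset.range N,
      (r ^ i - r ^ (i + 1)) * (c + r ^ i * ((1 + r) / 2) * (1 + i * l + k))⁻¹ ≤
    ∫ s in (r ^ N)..1, (c + entropyRate s)⁻¹ := by
  have hint : ∀ a b : ℝ, IntervalIntegrable (fun s => (c + entropyRate s)⁻¹) volume a b :=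
    fun a b => (continuous_inv_add_entropyRate hc).intervalIntegrable _ _
  induction N with
  | zero => simp
  | succ N ih =>
    rw [Finset.sum_range_succ, ← intervalIntegral.integral_add_adjacent_intervals
      (hint (r ^ (N + 1)) (r ^ N)) (hint _ _), add_comm]
    refine add_le_add ?_ ih
    refine le_integral_inv_add_entropyRate hc (by positivity)
      (pow_lt_pow_right_of_lt_one₀ hr0 hr1 (Nat.lt_succ_self N)) (pow_le_one₀ hr0.le hr1.le) ?_
    have e : (r ^ (N + 1) + r ^ N) / 2 = r ^ N * ((1 + r) / 2) := by ring
    have hp : r ^ N ≤ 1 := pow_le_one₀ hr0.le hr1.le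
    have hm0 : 0 < r ^ N * ((1 + r) / 2) := by positivity
    rw [e, entropyRate_eq hm0.le (mul_le_one₀ hp (by positivity) (by linarith)),
      Real.log_mul (by positivity) (by positivity), Real.log_pow]
    have : r ^ N * ((1 + r) / 2) - r ^ N * ((1 + r) / 2) * (N * Real.log r + Real.log ((1 + r) / 2))
      = r ^ N * ((1 + r) / 2) * (1 + N * (-Real.log r) + (-Real.log ((1 + r) / 2))) := by ring
    rw [this]
    gcongr

/-! ### Locating the constant numerically -/

/-- The time which the solution of `H' = H (ln H - 1) - c` takes to descend from `1` to `0`. -/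
noncomputable def descentTime (c : ℝ) : ℝ := ∫ s in (0 : ℝ)..1, (c + entropyRate s)⁻¹

lemma descentTime_lt_one : descentTime (51 / 149) < 1 := by
  have hc : (0 : ℝ) < 51 / 149 := by norm_num
  have hint : ∀ a b : ℝ,
      IntervalIntegrable (fun s => ((51 / 149 : ℝ) + entropyRate s)⁻¹) volume a b :=
    fun a b => (continuous_inv_add_entropyRate hc).intervalIntegrable _ _
  -- `9/8 = (1 + x) / (1 - x)` for `x = 1/17`, so the series for `log ((1 + x) / (1 - x))` applies.
  -- The constant `51/149` is `1/0.745 - 1`.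
  have hl : (11778 / 100000 : ℝ) ≤ -Real.log (8 / 9) := by
    have := Real.sum_range_le_log_div (x := 1 / 17) (by norm_num) (by norm_num) 3
    rw [← Real.log_inv]
    norm_num [Finset.sum_range_succ] at this ⊢
    linarith
  unfold descentTime
  rw [← intervalIntegral.integral_add_adjacent_intervals (hint 0 ((8 / 9 : ℝ) ^ 50)) (hint _ _)]
  have h1 := integral_pow_one_le_sum hc (by norm_num) (by norm_num) (by norm_num) hl 50
  have h2 : ∫ s in (0 : ℝ)..((8 / 9 : ℝ) ^ 50), ((51 / 149 : ℝ) + entropyRate s)⁻¹ ≤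
      ((8 / 9 : ℝ) ^ 50 - 0) * ((((51 / 149 : ℝ) + 0)⁻¹ + ((51 / 149 : ℝ) + 0)⁻¹) / 2) :=
    integral_inv_add_entropyRate_le hc le_rfl (by positivity)
      (pow_le_one₀ (by norm_num) (by norm_num)) le_rfl le_rfl (entropyRate_nonneg _)
      (entropyRate_nonneg _)
  refine lt_of_le_of_lt (add_le_add h2 h1) ?_
  norm_num [Finset.sum_range_succ]

/-- The constant `127/373` is `1/0.746 - 1`; here the midpoint sums on the grid of powers of `5/6`
already exceed `1`. -/
lemma one_lt_descentTime : 1 < descentTime (127 / 373) := by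
  have hc : (0 : ℝ) < 127 / 373 := by norm_num
  have hint : ∀ a b : ℝ,
      IntervalIntegrable (fun s => ((127 / 373 : ℝ) + entropyRate s)⁻¹) volume a b :=
    fun a b => (continuous_inv_add_entropyRate hc).intervalIntegrable _ _
  have hl : -Real.log (5 / 6) ≤ (18233 / 100000 : ℝ) := by
    have := Real.log_div_le_sum_range_add (x := 1 / 11) (by norm_num) (by norm_num) 3
    rw [← Real.log_inv]
    norm_num [Finset.sum_range_succ] at this ⊢
    linarith
  have hk : -Real.log ((1 + 5 / 6) / 2) ≤ (8702 / 100000 : ℝ) := by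
    have := Real.log_div_le_sum_range_add (x := 1 / 23) (by norm_num) (by norm_num) 3
    rw [← Real.log_inv]
    norm_num [Finset.sum_range_succ] at this ⊢
    linarith
  unfold descentTime
  rw [← intervalIntegral.integral_add_adjacent_intervals (hint 0 ((5 / 6 : ℝ) ^ 54)) (hint _ _)]
  have h1 := sum_le_integral_pow_one hc (by norm_num) (by norm_num) hl hk 54
  have h2 : ((5 / 6 : ℝ) ^ 54 - 0) * ((127 / 373 : ℝ) + 1)⁻¹ ≤
      ∫ s in (0 : ℝ)..((5 / 6 : ℝ) ^ 54), ((127 / 373 : ℝ) + entropyRate s)⁻¹ :=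
    le_integral_inv_add_entropyRate hc le_rfl (by positivity)
      (pow_le_one₀ (by norm_num) (by norm_num)) (entropyRate_le_one _)
  refine lt_of_lt_of_le ?_ (add_le_add h2 h1)
  norm_num [Finset.sum_range_succ]

lemma exists_descentTime_eq_one :
    ∃ c : ℝ, 127 / 373 < c ∧ c < 51 / 149 ∧ descentTime c = 1 := by
  have hcont : ContinuousOn descentTime (Icc (127 / 373) (51 / 149)) := by
    -- The `max` keeps the integrand continuous for every real parameter and changes nothing on the
    -- interval used.
    have h : Continuous fun c : ℝ => ∫ s in (0 : ℝ)..1, (max c (127 / 373) + entropyRate s)⁻¹ := by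
      apply intervalIntegral.continuous_parametric_intervalIntegral_of_continuous'
      refine Continuous.inv₀ ?_ fun p => ?_
      · have := continuous_entropyRate
        fun_prop
      · have h1 := entropyRate_nonneg p.2
        have h2 : (127 / 373 : ℝ) ≤ max p.1 (127 / 373) := le_max_right _ _
        have : 0 < max p.1 (127 / 373) + entropyRate p.2 := by linarith
        exact this.ne'
    refine h.continuousOn.congr fun c hc => ?_
    simp only [descentTime, max_eq_left hc.1]
  obtain ⟨c, hc, h1⟩ := intermediate_value_Ioo' (by norm_num) hcont
    ⟨descentTime_lt_one, one_lt_descentTime⟩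
  exact ⟨c, hc.1, hc.2, h1⟩

/-! ### Existence and uniqueness for the boundary value problem -/

/-- A strictly decreasing bijection of the line that is differentiable with nonvanishing derivative
has a differentiable strictly decreasing inverse. -/
lemma exists_strictAnti_inverse {T T' : ℝ → ℝ} (hT : ∀ y, HasDerivAt T (T' y) y)
    (hneg : ∀ y, T' y < 0) (htop : Tendsto T atTop atBot) (hbot : Tendsto T atBot atTop) :
    ∃ H : ℝ → ℝ, StrictAnti H ∧ (∀ y, H (T y) = y) ∧ ∀ x, HasDerivAt H (T' (H x))⁻¹ x := by
  have hc : Continuous T := continuous_iff_continuousAt.2 fun y => (hT y).continuousAt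
  have hanti : StrictAnti T := strictAnti_of_hasDerivAt_neg hT hneg
  have hsurj : Function.Surjective T := hc.surjective' hbot htop
  let e : ℝ ≃o ℝᵒᵈ := StrictMono.orderIsoOfSurjective (fun x => OrderDual.toDual (T x))
    (fun x y h => hanti h) hsurj
  have he : ∀ y, e y = OrderDual.toDual (T y) := fun y => rfl
  refine ⟨fun x => e.symm (OrderDual.toDual x), fun x y h => ?_, fun y => ?_, fun x => ?_⟩
  · exact e.symm.strictMono (OrderDual.toDual_lt_toDual.2 h)
  · exact e.symm_apply_apply y
  · have hr : ∀ x, T (e.symm (OrderDual.toDual x)) = x := fun x => by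
      have := e.apply_symm_apply (OrderDual.toDual x)
      rw [he] at this
      exact this
    refine HasDerivAt.of_local_left_inverse (f := T) ?_ (hT _) (hneg _).ne
      (Filter.Eventually.of_forall hr)
    exact (e.symm.continuous.comp continuous_toDual).continuousAt

/-- `H` is the inverse of `T y = 1 - ∫₀^y ds / (c + entropyRate s)`. The constant extension of
`entropyRate` bounds the integrand below by `1 / (c + 1)`, so `T` is a bijection of the whole line
and end points need no special care. -/
lemma exists_descent {c : ℝ} (hc : 0 < c) (h1 : descentTime c = 1) :
    ∃ H : ℝ → ℝ, StrictAnti H ∧ H 0 = 1 ∧ H 1 = 0 ∧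
      ∀ x, HasDerivAt H (-(c + entropyRate (H x))) x := by
  have hcont := continuous_inv_add_entropyRate hc
  have hT : ∀ y : ℝ, HasDerivAt (fun y => 1 - ∫ s in (0 : ℝ)..y, (c + entropyRate s)⁻¹)
      (-(c + entropyRate y)⁻¹) y := fun y => by
    simpa using (intervalIntegral.integral_hasDerivAt_right (hcont.intervalIntegrable _ _)
      (hcont.stronglyMeasurableAtFilter _ _) hcont.continuousAt).const_sub 1
  have hlow : ∀ s, (c + 1)⁻¹ ≤ (c + entropyRate s)⁻¹ := fun s => by
    have := entropyRate_nonneg s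
    have := entropyRate_le_one s
    gcongr
  have hc1 : 0 < (c + 1)⁻¹ := by positivity
  have htop : Tendsto (fun y => 1 - ∫ s in (0 : ℝ)..y, (c + entropyRate s)⁻¹) atTop atBot := by
    refine tendsto_atBot_mono' _ ((eventually_ge_atTop (0 : ℝ)).mono fun y hy => ?_)
      (tendsto_atBot_add_const_left _ 1
        (tendsto_neg_atTop_atBot.comp (tendsto_id.const_mul_atTop hc1)))
    have := intervalIntegral.integral_mono_on (μ := volume) hy intervalIntegrable_const
      (hcont.intervalIntegrable 0 y) fun s _ => hlow s
    simp only [intervalIntegral.integral_const, smul_eq_mul, Function.comp, id] at this ⊢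
    linarith
  have hbot : Tendsto (fun y => 1 - ∫ s in (0 : ℝ)..y, (c + entropyRate s)⁻¹) atBot atTop := by
    refine tendsto_atTop_mono' _ ((eventually_le_atBot (0 : ℝ)).mono fun y hy => ?_)
      (tendsto_atTop_add_const_left _ 1
        (tendsto_neg_atBot_atTop.comp (tendsto_id.const_mul_atBot hc1)))
    have := intervalIntegral.integral_mono_on (μ := volume) hy intervalIntegrable_const
      (hcont.intervalIntegrable y 0) fun s _ => hlow s
    have hs := intervalIntegral.integral_symm (μ := volume) y 0 (f := fun s => (c + entropyRate s)⁻¹)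
    simp only [hs, intervalIntegral.integral_const, smul_eq_mul, Function.comp, id] at this ⊢
    linarith
  obtain ⟨H, hanti, hinv, hder⟩ := exists_strictAnti_inverse hT
    (fun y => neg_neg_of_pos (hc1.trans_le (hlow y))) htop hbot
  refine ⟨H, hanti, ?_, ?_, fun x => ?_⟩
  · have := hinv 1
    rwa [← descentTime, h1, sub_self] at this
  · simpa using hinv 0
  · simpa using hder x

lemma isLimitConstant_of_descent {c : ℝ} (hc : 0 < c) {H : ℝ → ℝ} (hH : StrictAnti H)
    (h0 : H 0 = 1) (h1 : H 1 = 0) (hd : ∀ x, HasDerivAt H (-(c + entropyRate (H x))) x) :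
    IsLimitConstant (1 / (1 + c)) := by
  have hn : ∀ x ∈ Icc (0 : ℝ) 1, 0 ≤ H x := fun x hx => h1 ▸ hH.antitone hx.2
  refine ⟨by positivity, H, fun x => -(c + entropyRate (H x)), hn,
    fun x _ => (hd x).hasDerivWithinAt, fun x hx => ?_, h0, h1⟩
  simp only [entropyRate_eq (hn x hx) (h0 ▸ hH.antitone hx.1)]
  field_simp
  ring

/-- A function on `[0, 1]` whose derivative is positive at each of its zeros cannot vanish at both
end points. -/
lemma not_zero_both_ends_of_deriv_pos {D D' : ℝ → ℝ}
    (hD : ∀ x ∈ Icc (0 : ℝ) 1, HasDerivWithinAt D (D' x) (Icc 0 1) x)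
    (hpos : ∀ x ∈ Icc (0 : ℝ) 1, D x = 0 → 0 < D' x) (h0 : D 0 = 0) : D 1 ≠ 0 := by
  intro h1
  have hcont : ContinuousOn D (Icc 0 1) := fun x hx => (hD x hx).continuousWithinAt
  have hright : ∀ᶠ x in 𝓝[>] (0 : ℝ), 0 < D x := by
    have h := ((hD 0 (by simp)).mono_of_mem_nhdsWithin
      (Icc_mem_nhdsGE (by norm_num : (0 : ℝ) < 1)))
    have h2 := hasDerivWithinAt_iff_tendsto_slope.1 (h.mono Ioi_subset_Ici_self)
    have h3 := h2.eventually_const_lt (hpos 0 (by simp) h0)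
    rw [sdiff_singleton_eq_self (by simp)] at h3
    filter_upwards [h3, self_mem_nhdsWithin] with x hx hx0
    rw [slope_def_field, h0, sub_zero] at hx
    have : 0 < x - 0 := sub_pos.2 hx0
    exact (div_pos_iff_of_pos_right this).1 hx
  obtain ⟨a, haD, ha⟩ : ∃ a, 0 < D a ∧ a ∈ Ioo (0 : ℝ) 1 :=
    (hright.and (Ioo_mem_nhdsGT one_pos)).exists
  -- Its least element `b` is the first zero after `a`; since `D > 0` on `(a, b)`, the left slopes
  -- at `b` are negative.
  set S := {x ∈ Icc a 1 | D x = 0} with hS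
  have hSne : S.Nonempty := ⟨1, ⟨ha.2.le, le_rfl⟩, h1⟩
  have hScl : IsClosed S :=
    (hcont.mono (Icc_subset_Icc_left ha.1.le)).preimage_isClosed_of_isClosed isClosed_Icc
      isClosed_singleton
  have hSbdd : BddBelow S := ⟨a, fun x hx => hx.1.1⟩
  have hb := hScl.csInf_mem hSne hSbdd
  set b := sInf S
  have hab : a < b := lt_of_le_of_ne hb.1.1 fun h => by
    have := hb.2
    rw [← h] at this
    linarith
  have hbI : b ∈ Icc (0 : ℝ) 1 := ⟨ha.1.le.trans hb.1.1, hb.1.2⟩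
  have hpos' : ∀ x ∈ Ioo a b, 0 < D x := fun x hx => by
    by_contra hneg
    obtain ⟨z, hz, hz0⟩ := intermediate_value_Icc' hx.1.le
      (hcont.mono (Icc_subset_Icc ha.1.le (hx.2.le.trans hb.1.2))) ⟨not_lt.1 hneg, haD.le⟩
    have : b ≤ z := csInf_le hSbdd ⟨⟨hz.1, hz.2.trans (hx.2.le.trans hb.1.2)⟩, hz0⟩
    linarith [hz.2, hx.2]
  have h := (hD b hbI).mono (Ioo_subset_Icc_self.trans (Icc_subset_Icc ha.1.le hb.1.2) :
    Ioo a b ⊆ Icc 0 1)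
  have h2 := hasDerivWithinAt_iff_tendsto_slope.1 h
  rw [sdiff_singleton_eq_self (by simp), nhdsWithin_Ioo_eq_nhdsLT hab] at h2
  have h3 := h2.eventually_const_lt (hpos b hbI hb.2)
  obtain ⟨x, hx, hxI⟩ := (h3.and (Ioo_mem_nhdsLT hab)).exists
  rw [slope_def_field, hb.2, sub_zero] at hx
  have : D x / (x - b) < 0 := div_neg_of_pos_of_neg (hpos' x hxI) (by linarith [hxI.2])
  linarith

/-- Where two solutions meet, their slopes differ by exactly the difference of the constants, so the
difference has a positive derivative at each of its zeros. -/
lemma IsLimitConstant.le {θ₁ θ₂ : ℝ} (h₁ : IsLimitConstant θ₁) (h₂ : IsLimitConstant θ₂) :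
    θ₁ ≤ θ₂ := by
  obtain ⟨p₁, H, H', -, hd, he, a0, a1⟩ := h₁
  obtain ⟨p₂, K, K', -, kd, ke, b0, b1⟩ := h₂
  by_contra! hlt
  have hc : 1 / θ₁ - 1 < 1 / θ₂ - 1 := sub_lt_sub_right (one_div_lt_one_div_of_lt p₂ hlt) 1
  refine not_zero_both_ends_of_deriv_pos (D := fun x => H x - K x)
    (fun x hx => (hd x hx).sub (kd x hx)) (fun x hx h => ?_) (by simp [a0, b0]) (by simp [a1, b1])
  have h1 := he x hx
  have h2 := ke x hx
  have h3 : H x = K x := sub_eq_zero.1 h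
  rw [h3] at h1
  linarith

/-! ### Reduction to acceptance probabilities; the maximum is attained -/

lemma prophetCoeff_one (n : ℕ) (q : unitInterval) :
    prophetCoeff 1 n q = 1 - (1 - (q : ℝ)) ^ n := by
  have h : ∀ j : ℕ, min (j : ℝ) ((1 : ℕ) : ℝ) = 1 - Set.indicator {0} (fun _ => (1 : ℝ)) j := by
    intro j
    rcases Nat.eq_zero_or_pos j with rfl | hj
    · simp
    · have : (1 : ℝ) ≤ j := by exact_mod_cast hj
      simp [this, hj.ne']
  unfold prophetCoeff
  simp_rw [h]
  rw [integral_sub (integrable_const _)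
    ((integrable_const _).indicator (measurableSet_singleton 0)),
    integral_indicator_const _ (measurableSet_singleton 0)]
  simp

/-- The probability that the slot is still free, as a function of the acceptance probabilities. -/
def freeProb (y : ℕ → ℝ) (i : ℕ) : ℝ := 1 - ∑ j ∈ Finset.Ico 1 i, y j

lemma freeProb_one (y : ℕ → ℝ) : freeProb y 1 = 1 := by simp [freeProb]

lemma freeProb_succ (y : ℕ → ℝ) {i : ℕ} (hi : 1 ≤ i) : freeProb y (i + 1) = freeProb y i - y i := by
  simp only [freeProb, Finset.sum_Ico_succ_top hi]; ring

lemma IsStatePath.eq_freeProb {n : ℕ} {x y : ℕ → ℕ → ℝ} (h : IsStatePath 1 n x y) {i : ℕ}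
    (hi : i ∈ Finset.Icc 1 n) : x i 1 = freeProb (fun j => y j 1) i := by
  obtain ⟨h1, hn⟩ := Finset.mem_Icc.1 hi
  induction i, h1 using Nat.le_induction with
  | base => simpa [freeProb] using h.init 1 (by simp)
  | succ i h1 ih =>
    have := h.update (i + 1) (by simp; omega) 1 (by simp)
    simp only [Nat.add_sub_cancel, if_true, add_zero] at this
    rw [this, ih (by simp; omega) (by omega), freeProb_succ _ h1]

/-- Feasibility in terms of the acceptance probabilities only. -/
lemma mem_iidFeasible_one_iff {n : ℕ} {θ : ℝ} :
    θ ∈ iidFeasible 1 n ↔ ∃ y : ℕ → ℝ, (∀ i ∈ Finset.Icc 1 n, 0 ≤ y i ∧ y i ≤ freeProb y i) ∧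
      ∀ q ∈ Ioc (0 : ℝ) 1, θ * (1 - (1 - q) ^ n) ≤
        ∑ i ∈ Finset.Icc 1 n, min (y i) (q * freeProb y i) := by
  constructor
  · rintro ⟨x, y, hxy, h⟩
    refine ⟨fun i => y i 1, fun i hi => ⟨hxy.nonneg i hi 1 (by simp), ?_⟩, fun q hq => ?_⟩
    · rw [← hxy.eq_freeProb hi]
      exact hxy.le i hi 1 (by simp)
    · have := h ⟨q, hq.1.le, hq.2⟩ hq.1
      rw [prophetCoeff_one] at this
      simp only [Finset.Icc_self, Finset.sum_singleton] at this
      refine this.trans_eq (Finset.sum_congr rfl fun i hi => ?_)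
      rw [hxy.eq_freeProb hi]
  · rintro ⟨y, hy, h⟩
    refine ⟨fun i _ => freeProb y i, fun i _ => y i, ⟨?_, ?_, ?_, ?_⟩, fun q hq => ?_⟩
    · intro l hl
      simp only [Finset.Icc_self, Finset.mem_singleton] at hl
      simp [hl, freeProb_one]
    · intro i hi l hl
      simp only [Finset.Icc_self, Finset.mem_singleton] at hl
      obtain ⟨j, rfl⟩ : ∃ j, i = j + 1 := ⟨i - 1, by have := (Finset.mem_Icc.1 hi).1; omega⟩
      have hj : 1 ≤ j := by have := (Finset.mem_Icc.1 hi).1; omega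
      simp [hl, freeProb_succ y hj]
    · exact fun i hi _ _ => (hy i hi).2
    · exact fun i hi _ _ => (hy i hi).1
    · rw [prophetCoeff_one]
      simpa using h q ⟨hq, q.2.2⟩

lemma sum_eq_one_sub_freeProb (y : ℕ → ℝ) (n : ℕ) :
    ∑ i ∈ Finset.Icc 1 n, y i = 1 - freeProb y (n + 1) := by
  simp [freeProb, Finset.Ico_add_one_right_eq_Icc]

lemma freeProb_nonneg {y : ℕ → ℝ} {n i : ℕ}
    (hy : ∀ i ∈ Finset.Icc 1 n, 0 ≤ y i ∧ y i ≤ freeProb y i) (h1 : 1 ≤ i) (hi : i ≤ n + 1) :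
    0 ≤ freeProb y i := by
  induction i, h1 using Nat.le_induction with
  | base => simp [freeProb]
  | succ i h1 ih =>
    rw [freeProb_succ _ h1]
    exact sub_nonneg.2 (hy i (by simp; omega)).2

lemma freeProb_le_one {y : ℕ → ℝ} {n i : ℕ}
    (hy : ∀ i ∈ Finset.Icc 1 n, 0 ≤ y i ∧ y i ≤ freeProb y i) (hi : i ≤ n + 1) :
    freeProb y i ≤ 1 := by
  have : 0 ≤ ∑ j ∈ Finset.Ico 1 i, y j := Finset.sum_nonneg fun j hj =>
    (hy j (by simp at hj ⊢; omega)).1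
  simp only [freeProb]; linarith

lemma le_one_of_mem_iidFeasible {n : ℕ} (hn : 1 ≤ n) {θ : ℝ} (h : θ ∈ iidFeasible 1 n) :
    θ ≤ 1 := by
  obtain ⟨y, hy, h⟩ := mem_iidFeasible_one_iff.1 h
  have h1 := h 1 (by simp)
  have h2 : ∑ i ∈ Finset.Icc 1 n, min (y i) (1 * freeProb y i) ≤ ∑ i ∈ Finset.Icc 1 n, y i :=
    Finset.sum_le_sum fun i _ => min_le_left _ _
  rw [sum_eq_one_sub_freeProb y] at h2
  have h3 := freeProb_nonneg hy (Nat.succ_pos n) le_rfl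
  have h4 : ((1 : ℝ) - 1) ^ n = 0 := by rw [sub_self, zero_pow (by omega)]
  rw [h4] at h1
  linarith

lemma zero_mem_iidFeasible (n : ℕ) : (0 : ℝ) ∈ iidFeasible 1 n := by
  refine mem_iidFeasible_one_iff.2 ⟨fun _ => 0, fun i _ => by simp [freeProb], fun q hq => ?_⟩
  simp [freeProb, hq.1.le]

lemma continuous_freeProb (i : ℕ) : Continuous fun y : ℕ → ℝ => freeProb y i := by
  unfold freeProb
  fun_prop

/-- Compactness: the constraints are closed conditions on `(θ, y)`, and nonnegative feasible `θ` can
be realized within a cube. -/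
lemma isGreatest_iidLP {n : ℕ} (hn : 1 ≤ n) : IsGreatest (iidFeasible 1 n) (iidLP 1 n) := by
  let K : Set (ℝ × (ℕ → ℝ)) := {p | ∀ i ∈ Finset.Icc 1 n, 0 ≤ p.2 i ∧ p.2 i ≤ freeProb p.2 i} ∩
    {p | ∀ q ∈ Ioc (0 : ℝ) 1, p.1 * (1 - (1 - q) ^ n) ≤
        ∑ i ∈ Finset.Icc 1 n, min (p.2 i) (q * freeProb p.2 i)}
  have hKcl : IsClosed K := by
    refine IsClosed.inter ?_ ?_
    · simp only [ofPred_forall, ofPred_and]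
      refine isClosed_iInter fun i => isClosed_iInter fun _ => IsClosed.inter ?_ ?_
      · exact isClosed_le continuous_const (by fun_prop)
      · exact isClosed_le (by fun_prop) ((continuous_freeProb i).comp continuous_snd)
    · simp only [ofPred_forall]
      refine isClosed_iInter fun q => isClosed_iInter fun _ => isClosed_le (by fun_prop) ?_
      refine continuous_finsetSum _ fun i _ => Continuous.min (by fun_prop) ?_
      exact continuous_const.mul ((continuous_freeProb i).comp continuous_snd)
  have hcpt : IsCompact (Icc (0 : ℝ) 1 ×ˢ (univ.pi fun _ : ℕ => Icc (0 : ℝ) 1)) :=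
    isCompact_Icc.prod (isCompact_univ_pi fun _ => isCompact_Icc)
  have himg := (hcpt.inter_right hKcl).image continuous_fst
  have hmem : ∀ θ : ℝ, 0 ≤ θ → θ ∈ iidFeasible 1 n →
      θ ∈ Prod.fst '' ((Icc (0 : ℝ) 1 ×ˢ (univ.pi fun _ : ℕ => Icc (0 : ℝ) 1)) ∩ K) := by
    intro θ h0 hθ
    obtain ⟨y, hy, h⟩ := mem_iidFeasible_one_iff.1 hθ
    -- Values outside `1, …, n` are arbitrary; zeroing them places the policy in the compact cube.
    let z : ℕ → ℝ := fun i => if i ∈ Finset.Icc 1 n then y i else 0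
    have hz : ∀ i ∈ Finset.Icc 1 n, z i = y i := fun i hi => if_pos hi
    have hf : ∀ i ∈ Finset.Icc 1 n, freeProb z i = freeProb y i := fun i hi => by
      unfold freeProb
      congr 1
      refine Finset.sum_congr rfl fun j hj => hz j ?_
      simp only [Finset.mem_Icc, Finset.mem_Ico] at hi hj ⊢
      omega
    refine ⟨(θ, z), ⟨⟨⟨h0, le_one_of_mem_iidFeasible hn hθ⟩, fun i _ => ?_⟩, fun i hi => ?_,
      fun q hq => ?_⟩, rfl⟩
    · by_cases hi : i ∈ Finset.Icc 1 n
      · simp only [hz i hi]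
        exact ⟨(hy i hi).1, (hy i hi).2.trans
          (freeProb_le_one hy (by have := (Finset.mem_Icc.1 hi).2; omega))⟩
      · simp only [z, if_neg hi]
        simp
    · simp only [hz i hi, hf i hi]
      exact hy i hi
    · refine (h q hq).trans_eq (Finset.sum_congr rfl fun i hi => ?_)
      simp only [hz i hi, hf i hi]
  obtain ⟨θ, ⟨p, ⟨hp, hpK⟩, rfl⟩, hmax⟩ :=
    himg.exists_isGreatest ⟨0, hmem 0 le_rfl (zero_mem_iidFeasible n)⟩
  have hg : IsGreatest (iidFeasible 1 n) p.1 := by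
    refine ⟨mem_iidFeasible_one_iff.2 ⟨p.2, hpK.1, hpK.2⟩, fun θ' hθ' => ?_⟩
    rcases le_total 0 θ' with h0 | h0
    · exact hmax (hmem θ' h0 hθ')
    · exact h0.trans hp.1.1
  have : iidLP 1 n = p.1 := hg.csSup_eq
  rwa [this]

/-! ### Comparing one step of the recursion with the differential equation -/

lemma entropyRate_mono {a b : ℝ} (ha : 0 ≤ a) (hab : a ≤ b) (hb : b ≤ 1) :
    entropyRate a ≤ entropyRate b := by
  rcases (ha.trans hab).eq_or_lt with h0 | h0
  · rw [le_antisymm (h0 ▸ hab) ha, ← h0]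
  · have h := entropyRate_le_tangent ha (hab.trans hb) h0 hb
    have := mul_nonneg_of_nonpos_of_nonpos (Real.log_nonpos h0.le hb) (sub_nonpos.2 hab)
    linarith

/-- A function that does not decrease where it is negative stays nonnegative. -/
lemma nonneg_of_deriv_nonneg_of_neg {D D' : ℝ → ℝ} {τ : ℝ} (hτ : 0 ≤ τ)
    (hD : ∀ x ∈ Icc 0 τ, HasDerivAt D (D' x) x) (h0 : 0 ≤ D 0)
    (h : ∀ x ∈ Icc 0 τ, D x < 0 → 0 ≤ D' x) : 0 ≤ D τ := by
  by_contra! hneg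
  have hε : 0 < -D τ / (2 * (1 + τ)) := by
    have : 0 < -D τ := by linarith
    positivity
  -- The barrier `ε (1 + x)` for `-D` is positive with positive slope and equals `-D τ / 2` at `τ`,
  -- below `-D τ`.
  set ε := -D τ / (2 * (1 + τ)) with hεdef
  have key := image_le_of_deriv_right_lt_deriv_boundary' (f := fun x => -D x)
    (f' := fun x => -D' x) (a := 0) (b := τ) (B := fun x => ε * (1 + x)) (B' := fun _ => ε)
    (fun x hx => (hD x hx).neg.continuousAt.continuousWithinAt)
    (fun x hx => (hD x ⟨hx.1, hx.2.le⟩).neg.hasDerivWithinAt) (by simp; linarith)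
    (by fun_prop)
    (fun x _ => by
      simpa using (((hasDerivAt_id x).const_add 1).const_mul ε).hasDerivWithinAt)
    (fun x hx he => by
      have hx0 : 0 ≤ x := hx.1
      have : 0 < ε * (1 + x) := by positivity
      have := h x ⟨hx.1, hx.2.le⟩ (by
        have he' : -D x = ε * (1 + x) := he
        linarith)
      linarith)
    (right_mem_Icc.2 hτ)
  have e : ε * (1 + τ) = -D τ / 2 := by rw [hεdef]; field_simp
  simp only [e] at key
  linarith

/-- One recursion step becomes a curve in the step length `x`. With `v = exp (L / (1 - x))` its
slope is `-(c + v - v ln v)`, the right side of the differential equation at `v`. -/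
lemma hasDerivAt_one_sub_mul_exp_div (L c : ℝ) {x : ℝ} (hx : x < 1) :
    HasDerivAt (fun x => (1 - x) * Real.exp (L / (1 - x)) - c * x)
      (-(c + (Real.exp (L / (1 - x)) - Real.exp (L / (1 - x)) * (L / (1 - x))))) x := by
  have hx' : 1 - x ≠ 0 := by linarith
  have h1 : HasDerivAt (fun x : ℝ => 1 - x) (-1) x := by
    simpa using (hasDerivAt_id x).const_sub 1
  have h2 := ((hasDerivAt_const x L).div h1 hx').exp
  refine ((h1.mul h2).sub ((hasDerivAt_id x).const_mul c)).congr_deriv ?_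
  simp only [Pi.div_apply]
  field_simp
  ring

/-- One step of the finite recursion stays below the solution of the differential equation. -/
lemma rpow_sub_le_descent {c : ℝ} (hc : 0 < c) {H : ℝ → ℝ} (hH : StrictAnti H)
    (h0 : H 0 = 1) (h1 : H 1 = 0) (hd : ∀ x, HasDerivAt H (-(c + entropyRate (H x))) x)
    {t τ : ℝ} (ht : 0 ≤ t) (hτ : 0 ≤ τ) (hτ1 : τ < 1) (htτ : t + τ ≤ 1) :
    (1 - τ) * H t ^ (1 / (1 - τ)) - c * τ ≤ H (t + τ) := by
  have hHn : ∀ x ≤ 1, 0 ≤ H x := fun x hx => h1 ▸ hH.antitone hx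
  rcases (hHn t (by linarith)).eq_or_lt with hz | hpos
  · rw [← hz, Real.zero_rpow (by have : 0 < 1 - τ := by linarith
                                 positivity)]
    have := hHn _ htτ
    have := mul_nonneg hc.le hτ
    linarith
  · have hL : Real.log (H t) ≤ 0 := Real.log_nonpos hpos.le (h0 ▸ hH.antitone ht)
    set L := Real.log (H t) with hLdef
    have key := nonneg_of_deriv_nonneg_of_neg
      (D := fun x => H (t + x) - ((1 - x) * Real.exp (L / (1 - x)) - c * x)) hτ
      (fun x hx => ((hd (t + x)).comp_const_add t x).sub
        (hasDerivAt_one_sub_mul_exp_div L c (hx.2.trans_lt hτ1)))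
      (by simp [hLdef, Real.exp_log hpos])
      -- If `H` is below the curve, it is below `v`, since the curve is; monotonicity of
      -- `entropyRate` then makes `H` fall no faster than the curve.
      (fun x hx hneg => by
        have hx1 : 0 < 1 - x := by linarith [hx.2]
        have hLx : L / (1 - x) ≤ 0 := div_nonpos_of_nonpos_of_nonneg hL hx1.le
        have hv1 : Real.exp (L / (1 - x)) ≤ 1 := Real.exp_le_one_iff.2 hLx
        have hv0 := Real.exp_pos (L / (1 - x))
        have hle : H (t + x) ≤ Real.exp (L / (1 - x)) := by
          have := mul_nonneg hc.le hx.1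
          have := mul_nonneg hx.1 hv0.le
          linarith
        have hm := entropyRate_mono (hHn (t + x) (by linarith [hx.2])) hle hv1
        rw [entropyRate_eq hv0.le hv1, Real.log_exp] at hm
        linarith)
    rw [Real.rpow_def_of_pos hpos, ← hLdef, mul_one_div]
    linarith

/-! ### A policy achieving the constant for every number of agents -/

/-- The graph of `t ↦ t^(m + 1)` lies above its tangent at `a`. -/
lemma succ_mul_mul_pow_le (m : ℕ) {a b : ℝ} (ha : 0 ≤ a) (hb : 0 ≤ b) :
    (m + 1) * b * a ^ m ≤ m * a ^ (m + 1) + b ^ (m + 1) := by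
  induction m with
  | zero => simp
  | succ m ih =>
    have h1 := mul_le_mul_of_nonneg_left ih ha
    have h2 : 0 ≤ (a - b) * (a ^ (m + 1) - b ^ (m + 1)) := by
      rcases le_total a b with h | h
      · exact mul_nonneg_of_nonpos_of_nonpos (sub_nonpos.2 h)
          (sub_nonpos.2 (pow_le_pow_left₀ ha h _))
      · exact mul_nonneg (sub_nonneg.2 h) (sub_nonneg.2 (pow_le_pow_left₀ hb h _))
    push_cast
    ring_nf at h1 h2 ⊢
    linarith

/-- The function `t ↦ m t^(m + 1) - (m + 1) p t^m` has derivative `m (m + 1) t^(m - 1) (t - p)`: it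
falls up to `p` and rises afterwards. -/
lemma pow_gap_monotone_right (m : ℕ) {p a b : ℝ} (hp : 0 ≤ p) (hpb : p ≤ b) (hba : b ≤ a) :
    m * b ^ (m + 1) - (m + 1) * p * b ^ m ≤ m * a ^ (m + 1) - (m + 1) * p * a ^ m := by
  have hb := hp.trans hpb
  have h1 := succ_mul_mul_pow_le m (hb.trans hba) hb
  have h2 : 0 ≤ (m + 1) * ((b - p) * (a ^ m - b ^ m)) := by
    have := mul_nonneg (sub_nonneg.2 hpb) (sub_nonneg.2 (pow_le_pow_left₀ hb hba m))
    positivity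
  have e : b ^ (m + 1) = b * b ^ m := by ring
  rw [e] at h1 ⊢
  linarith

lemma pow_gap_antitone_left (m : ℕ) {p a b : ℝ} (hb : 0 ≤ b) (hba : b ≤ a) (hap : a ≤ p) :
    m * a ^ (m + 1) - (m + 1) * p * a ^ m ≤ m * b ^ (m + 1) - (m + 1) * p * b ^ m := by
  have ha := hb.trans hba
  have h1 := succ_mul_mul_pow_le m hb ha
  have h2 : 0 ≤ (m + 1) * ((p - a) * (a ^ m - b ^ m)) := by
    have := mul_nonneg (sub_nonneg.2 hap) (sub_nonneg.2 (pow_le_pow_left₀ hb hba m))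
    positivity
  have e : a ^ (m + 1) = a * a ^ m := by ring
  rw [e] at h1 ⊢
  linarith

/-- For one threshold, the guaranteed contribution up to level `s`, where `p` is the probability
that an agent fails the threshold. -/
noncomputable def guarantee (m : ℕ) (p s : ℝ) : ℝ :=
  (m + 1) * (1 - p) * s ^ m -
    (m * max s p ^ (m + 1) - (m + 1) * p * max s p ^ m + p ^ (m + 1))

lemma guarantee_zero {m : ℕ} (hm : m ≠ 0) {p : ℝ} (hp : 0 ≤ p) : guarantee m p 0 = 0 := by
  simp only [guarantee, max_eq_right hp, zero_pow hm]; ring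

lemma guarantee_one (m : ℕ) {p : ℝ} (hp : p ≤ 1) : guarantee m p 1 = 1 - p ^ (m + 1) := by
  simp only [guarantee, max_eq_left hp]; ring

/-- On `s ≥ 0`, for `m ≥ 1`, `guarantee m p` has density `m (m + 1) t^(m - 1) min (1 - t) (1 - p)`.
Here the minimum is bounded by `1 - p`; `guarantee_sub_le_accept` bounds it by `1 - t`. -/
lemma guarantee_sub_le_threshold (m : ℕ) {p a b : ℝ} (hp : 0 ≤ p) (hba : b ≤ a) :
    guarantee m p a - guarantee m p b ≤ (m + 1) * (1 - p) * (a ^ m - b ^ m) := by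
  have := pow_gap_monotone_right m hp (le_max_right b p) (max_le_max_right p hba)
  simp only [guarantee]
  linarith

/-- The density bound by `1 - t` integrates to `(m + 1) s^m - m s^(m + 1)`. Replacing `m s^(m + 1)`
by its truncation `max 0 (· - c)` only helps, because truncation does not enlarge increments. -/
lemma guarantee_sub_le_accept (m : ℕ) {c p a b : ℝ} (hp : 0 ≤ p) (hb : 0 ≤ b)
    (hba : b ≤ a) :
    guarantee m p a - guarantee m p b ≤
      ((m + 1) * a ^ m - max 0 (m * a ^ (m + 1) - c)) -
        ((m + 1) * b ^ m - max 0 (m * b ^ (m + 1) - c)) := by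
  have hr : ∀ s, guarantee m p s = (m + 1) * s ^ m - m * s ^ (m + 1) +
      (m * min s p ^ (m + 1) - (m + 1) * p * min s p ^ m) := fun s => by
    simp only [guarantee]
    rcases le_total s p with h | h
    · rw [max_eq_right h, min_eq_left h]; ring
    · rw [max_eq_left h, min_eq_right h]; ring
  have h1 := pow_gap_antitone_left m (le_min hb hp) (min_le_min_right p hba) (min_le_right a p)
  have h2 : (m : ℝ) * b ^ (m + 1) ≤ m * a ^ (m + 1) := by gcongr
  have h3 : max 0 (m * a ^ (m + 1) - c) - max 0 (m * b ^ (m + 1) - c) ≤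
      m * a ^ (m + 1) - m * b ^ (m + 1) := by
    rcases le_total 0 (m * b ^ (m + 1) - c) with h | h
    · rw [max_eq_right h, max_eq_right (by linarith)]; linarith
    · rw [max_eq_left h]
      rcases le_total 0 (m * a ^ (m + 1) - c) with h' | h'
      · rw [max_eq_right h']; linarith
      · rw [max_eq_left h']; linarith
  rw [hr, hr]
  linarith

/-- A sequence descending from `1` to `0` by the tight recursion yields a feasible policy. -/
lemma mem_iidFeasible_of_recursion {m : ℕ} (hm : m ≠ 0) {θ c : ℝ} (hθ : 0 < θ)
    (hc : c = 1 / θ - 1) (hcm : c ≤ m) {s : ℕ → ℝ} (hs0 : s 0 = 1)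
    (hs : ∀ j, 0 ≤ s j) (hs1 : ∀ j, s (j + 1) ≤ s j)
    (hrec : ∀ j, (m + 1) * s (j + 1) ^ m = max 0 (m * s j ^ (m + 1) - c))
    (hend : s (m + 1) = 0) : θ ∈ iidFeasible 1 (m + 1) := by
  -- `X j` is the probability that agent `j + 1` finds the slot free; `X 0 = 1` is what fixes `c =
  -- 1/θ - 1`.
  let X : ℕ → ℝ := fun j => θ * ((m + 1) * s j ^ m - (m + 1) * s (j + 1) ^ m)
  let y : ℕ → ℝ := fun i => X (i - 1) - X i
  have hX0 : X 0 = 1 := by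
    have h1 := hrec 0
    rw [hs0, one_pow, max_eq_right (by linarith)] at h1
    simp only [X, h1, hs0, hc]
    field_simp
    ring
  have hfree : ∀ j, freeProb y (j + 1) = X j := fun j => by
    induction j with
    | zero => simp [freeProb, hX0]
    | succ j ih =>
      rw [freeProb_succ y (by omega), ih]
      simp [y]
  have hXn : ∀ j, 0 ≤ X j := fun j => by
    have : s (j + 1) ^ m ≤ s j ^ m := pow_le_pow_left₀ (hs _) (hs1 j) m
    refine mul_nonneg hθ.le (sub_nonneg.2 ?_)
    gcongr
  have hg : ∀ j, ∀ p, 0 ≤ p → θ * (guarantee m p (s j) - guarantee m p (s (j + 1))) ≤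
      min (X j - X (j + 1)) ((1 - p) * X j) := fun j p hp => by
    refine le_min ?_ ?_
    · have h := mul_le_mul_of_nonneg_left
        (guarantee_sub_le_accept m (c := c) hp (hs (j + 1)) (hs1 j)) hθ.le
      rw [← hrec, ← hrec] at h
      exact h.trans_eq (by simp only [X]; ring)
    · have h := mul_le_mul_of_nonneg_left (guarantee_sub_le_threshold m hp (hs1 j)) hθ.le
      exact h.trans_eq (by simp only [X]; ring)
  refine mem_iidFeasible_one_iff.2 ⟨y, fun i hi => ?_, fun q hq => ?_⟩
  · obtain ⟨j, rfl⟩ : ∃ j, i = j + 1 := ⟨i - 1, by have := (Finset.mem_Icc.1 hi).1; omega⟩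
    rw [hfree, show y (j + 1) = X j - X (j + 1) from rfl]
    refine ⟨?_, by linarith [hXn (j + 1)]⟩
    -- At `p = 1` the guarantee vanishes on `[0, 1]`, so the bound says precisely that `y` is
    -- nonnegative.
    have h1 := (hg j 1 zero_le_one).trans (min_le_left _ _)
    have h2 : ∀ t ≤ (1 : ℝ), guarantee m 1 t = 0 := fun t ht => by
      simp only [guarantee, max_eq_right ht]; ring
    have h3 : ∀ j, s j ≤ 1 := fun j => by
      induction j with
      | zero => exact hs0.le
      | succ j ih => exact (hs1 j).trans ih
    rw [h2 _ (h3 j), h2 _ (h3 _)] at h1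
    linarith
  · have hp : 0 ≤ 1 - q := by linarith [hq.2]
    have htel := Finset.sum_range_sub' (fun j => guarantee m (1 - q) (s j)) (m + 1)
    rw [hs0, hend, guarantee_zero hm hp, guarantee_one m (by linarith [hq.1])] at htel
    rw [← sub_zero (1 - (1 - q) ^ (m + 1)), ← htel, Finset.mul_sum,
      ← Finset.Ico_add_one_right_eq_Icc 1 (m + 1), Finset.sum_Ico_eq_sum_range]
    refine Finset.sum_le_sum fun j _ => ?_
    rw [add_comm 1 j, hfree]
    simpa [y] using hg j (1 - q) hp

lemma mem_iidFeasible_one_one {θ : ℝ} (hθ : θ ≤ 1) : θ ∈ iidFeasible 1 1 := by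
  refine mem_iidFeasible_one_iff.2 ⟨fun _ => 1, fun i hi => ?_, fun q hq => ?_⟩
  · simp only [Finset.Icc_self, Finset.mem_singleton] at hi
    simp [hi, freeProb]
  · simp only [Finset.Icc_self, Finset.sum_singleton, freeProb_one, mul_one, min_eq_right hq.2]
    nlinarith [hq.1]

lemma mem_iidFeasible_of_descent {c : ℝ} (hc : 0 < c) (hc1 : c ≤ 1) {H : ℝ → ℝ}
    (hH : StrictAnti H) (h0 : H 0 = 1) (h1 : H 1 = 0)
    (hd : ∀ x, HasDerivAt H (-(c + entropyRate (H x))) x) {n : ℕ} (hn : 1 ≤ n) :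
    1 / (1 + c) ∈ iidFeasible 1 n := by
  obtain ⟨m, rfl⟩ : ∃ m, n = m + 1 := ⟨n - 1, by omega⟩
  rcases Nat.eq_zero_or_pos m with rfl | hm
  · exact mem_iidFeasible_one_one (by rw [div_le_one (by positivity)]; linarith)
  have hm' : (1 : ℝ) ≤ m := by exact_mod_cast hm
  have hm0 : (m : ℝ) ≠ 0 := by positivity
  let s : ℕ → ℝ := fun j =>
    Nat.rec 1 (fun _ t => (max 0 (m * t ^ (m + 1) - c) / (m + 1)) ^ (1 / (m : ℝ))) j
  have hsucc : ∀ j, s (j + 1) = (max 0 (m * s j ^ (m + 1) - c) / (m + 1)) ^ (1 / (m : ℝ)) :=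
    fun j => rfl
  have hnn : ∀ j, 0 ≤ max 0 (m * s j ^ (m + 1) - c) / (m + 1) := fun j => by positivity
  have hs : ∀ j, 0 ≤ s j := fun j => by
    cases j with
    | zero => exact zero_le_one
    | succ j => rw [hsucc]; exact Real.rpow_nonneg (hnn j) _
  have hpow : ∀ j, s (j + 1) ^ m = max 0 (m * s j ^ (m + 1) - c) / (m + 1) := fun j => by
    rw [hsucc, one_div, Real.rpow_inv_natCast_pow (hnn j) hm.ne']
  have hstep : ∀ j, s j ≤ 1 → s (j + 1) ≤ s j := fun j hj => by
    refine le_of_pow_le_pow_left₀ hm.ne' (hs j) ?_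
    rw [hpow, div_le_iff₀ (by positivity)]
    have h2 : 0 ≤ s j ^ m := pow_nonneg (hs j) m
    refine max_le (by positivity) ?_
    have h3 : s j ^ (m + 1) ≤ s j ^ m := pow_le_pow_of_le_one (hs j) hj (Nat.le_succ m)
    nlinarith
  have hle1 : ∀ j, s j ≤ 1 := fun j => by
    induction j with
    | zero => exact le_rfl
    | succ j ih => exact (hstep j ih).trans ih
  have hHn : ∀ x ≤ 1, 0 ≤ H x := fun x hx => h1 ▸ hH.antitone hx
  have hcomp : ∀ j : ℕ, j ≤ m + 1 → s j ^ m ≤ H (j / (m + 1)) := fun j hj => by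
    induction j with
    | zero => simp [s, h0]
    | succ j ih =>
      have hjm : (j : ℝ) + 1 ≤ m + 1 := by exact_mod_cast hj
      have e1 : ((j + 1 : ℕ) : ℝ) / (m + 1) = j / (m + 1) + 1 / (m + 1) := by
        push_cast; ring
      have hle : (j : ℝ) / (m + 1) + 1 / (m + 1) ≤ 1 := by
        rw [← add_div, div_le_one (by positivity)]; exact hjm
      -- For `w = s j^m` and `τ = 1 / (m + 1)` the recursion reads `w ↦ max 0 ((1 - τ) w^(1 / (1 -
      -- τ)) - c τ)`.
      have key := rpow_sub_le_descent hc hH h0 h1 hd (t := j / (m + 1)) (τ := 1 / (m + 1))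
        (by positivity) (by positivity) (by rw [div_lt_one (by positivity)]; linarith) hle
      have e2 : (1 : ℝ) - 1 / (m + 1) = m / (m + 1) := by field_simp; ring
      have e3 : (1 : ℝ) / (m / (m + 1)) = (m + 1 : ℕ) / (m : ℝ) := by push_cast; field_simp
      rw [e2, e3] at key
      have h4 : s j ^ (m + 1) ≤ H (j / (m + 1)) ^ ((m + 1 : ℕ) / (m : ℝ)) := by
        have h5 := Real.rpow_le_rpow (pow_nonneg (hs j) m) (ih (by omega))
          (by positivity : (0 : ℝ) ≤ (m + 1 : ℕ) / (m : ℝ))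
        rwa [← Real.rpow_natCast_mul (hs j), mul_div_cancel₀ _ hm0, Real.rpow_natCast] at h5
      rw [hpow, e1, ← max_div_div_right (by positivity), zero_div]
      refine max_le (hHn _ hle) (le_trans ?_ key)
      rw [sub_div, mul_one_div]
      refine sub_le_sub_right ?_ _
      rw [mul_div_right_comm]
      gcongr
  refine mem_iidFeasible_of_recursion hm.ne' (by positivity) (by field_simp; ring)
    (hc1.trans hm') (s := s) rfl hs (fun j => hstep j (hle1 j))
    (fun j => by rw [hpow]; field_simp) ?_
  have hlast := hcomp (m + 1) le_rfl
  push_cast at hlast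
  rw [div_self (by positivity), h1] at hlast
  exact eq_zero_of_pow_eq_zero (le_antisymm hlast (pow_nonneg (hs (m + 1)) m))

/-! ### The asymptotic upper bound -/

lemma mem_iidFeasible_of_le {n : ℕ} {θ θ' : ℝ} (h : θ' ∈ iidFeasible 1 n) (hle : θ ≤ θ') :
    θ ∈ iidFeasible 1 n := by
  obtain ⟨y, hy, hq⟩ := mem_iidFeasible_one_iff.1 h
  refine mem_iidFeasible_one_iff.2 ⟨y, hy, fun q hq' => le_trans ?_ (hq q hq')⟩
  have : (1 - q) ^ n ≤ 1 := pow_le_one₀ (by linarith [hq'.2]) (by linarith [hq'.1])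
  exact mul_le_mul_of_nonneg_right hle (by linarith)

/-- The expected number of agents after the `j`-th that meet a free slot. -/
def remainingProb (n : ℕ) (y : ℕ → ℝ) (j : ℕ) : ℝ := ∑ i ∈ Finset.Ico (j + 1) (n + 1), freeProb y i

lemma remainingProb_sub {n : ℕ} (y : ℕ → ℝ) {j : ℕ} (hj : j < n) :
    remainingProb n y j = freeProb y (j + 1) + remainingProb n y (j + 1) :=
  Finset.sum_eq_sum_Ico_succ_bot (by omega) _

/-- Each minimum is bounded by the acceptance probability up to agent `j` and by the threshold term
afterwards. -/
lemma threshold_bound {n : ℕ} {θ : ℝ} {y : ℕ → ℝ}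
    (h : ∀ q ∈ Ioc (0 : ℝ) 1, θ * (1 - (1 - q) ^ n) ≤
        ∑ i ∈ Finset.Icc 1 n, min (y i) (q * freeProb y i))
    (hfree : ∀ i, i ≤ n + 1 → freeProb y i ≤ 1) {j : ℕ} (hj : j ≤ n) {q : ℝ}
    (hq : q ∈ Icc (0 : ℝ) 1) :
    θ * (1 - (1 - q) ^ n) ≤ 1 - freeProb y (j + 1) + q * remainingProb n y j := by
  rcases hq.1.eq_or_lt with rfl | hq0
  · simpa using hfree (j + 1) (by omega)
  refine (h q ⟨hq0, hq.2⟩).trans ?_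
  rw [← sum_eq_one_sub_freeProb, remainingProb, Finset.mul_sum,
    ← Finset.Ico_add_one_right_eq_Icc, ← Finset.Ico_add_one_right_eq_Icc,
    ← Finset.sum_Ico_consecutive _ (by omega : 1 ≤ j + 1) (by omega : j + 1 ≤ n + 1)]
  exact add_le_add (Finset.sum_le_sum fun i _ => min_le_left _ _)
    (Finset.sum_le_sum fun i _ => min_le_right _ _)

lemma exists_pow_eq_exp_log_div {m : ℕ} (hm : m ≠ 0) {v : ℝ} (hv : 0 < v) (hv1 : v ≤ 1) :
    ∃ p ∈ Ioc (0 : ℝ) 1, p ^ m = v ∧ m + Real.log v ≤ m * p := by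
  have hm' : (0 : ℝ) < m := by positivity
  refine ⟨Real.exp (Real.log v / m), ⟨Real.exp_pos _, Real.exp_le_one_iff.2
    (div_nonpos_of_nonpos_of_nonneg (Real.log_nonpos hv.le hv1) hm'.le)⟩, ?_, ?_⟩
  · rw [← Real.exp_nat_mul, mul_div_cancel₀ _ hm'.ne', Real.exp_log hv]
  · have h := mul_le_mul_of_nonneg_left (Real.add_one_le_exp (Real.log v / m)) hm'.le
    rw [mul_add, mul_div_cancel₀ _ hm'.ne'] at h
    linarith

/-- A sequence that satisfies the Euler step of the differential equation with slack bounds the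
remaining probabilities of a feasible policy from below. -/
lemma le_remainingProb {m : ℕ} (hm : m ≠ 0) {θ : ℝ} (hθ : 0 < θ) {y : ℕ → ℝ}
    (h : ∀ q ∈ Ioc (0 : ℝ) 1, θ * (1 - (1 - q) ^ (m + 1)) ≤
        ∑ i ∈ Finset.Icc 1 (m + 1), min (y i) (q * freeProb y i))
    (hfree : ∀ i, i ≤ m + 1 + 1 → freeProb y i ≤ 1) {v : ℕ → ℝ} (hv0 : v 0 < 1)
    (hv : ∀ j ≤ m + 1, 0 < v j ∧ v j ≤ 1)
    (hstep : ∀ j < m + 1, (m + 1) * (v (j + 1) - v j) ≤ -entropyRate (v j) - (1 / θ - 1)) :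
    ∀ j ≤ m + 1, θ * ((m + 1) * v j) ≤ remainingProb (m + 1) y j := by
  intro j hj
  induction j with
  | zero =>
    -- The initial bound is divided by `1 - p`, hence the strict requirement `v 0 < 1`.
    obtain ⟨p, hp, hpm, -⟩ := exists_pow_eq_exp_log_div hm (hv 0 hj).1 (hv 0 hj).2
    have hp1 : p < 1 := lt_of_le_of_ne hp.2 fun h => by
      rw [h, one_pow] at hpm
      linarith
    have hb := threshold_bound h hfree (Nat.zero_le _) (q := 1 - p)
      ⟨by linarith, by linarith [hp.1]⟩
    have hA := succ_mul_mul_pow_le m hp.1.le zero_le_one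
    rw [freeProb_one, sub_self, zero_add, sub_sub_cancel] at hb
    rw [one_pow, hpm] at hA
    have e : p ^ (m + 1) = v 0 * p := by rw [pow_succ, hpm]
    rw [e] at hA hb
    have h1 : θ * ((m + 1) * v 0) * (1 - p) ≤ θ * (1 - v 0 * p) := by
      have := mul_le_mul_of_nonneg_left hA hθ.le
      linarith
    refine le_of_mul_le_mul_right ?_ (sub_pos.2 hp1)
    linarith
  | succ j ih =>
    have ih := ih (by omega)
    obtain ⟨hvp, hv1⟩ := hv j (by omega)
    -- With `R` the remaining sum, the next one is at least `p R + θ (1 - p^(m + 1)) - 1`. For `R =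
    -- θ (m + 1) v j`, this is largest at `p^m = v j`.
    obtain ⟨p, hp, hpm, hlog⟩ := exists_pow_eq_exp_log_div hm hvp hv1
    have hb := threshold_bound h hfree (by omega : j ≤ m + 1) (q := 1 - p)
      ⟨by linarith [hp.2], by linarith [hp.1]⟩
    have e : p ^ (m + 1) = v j * p := by rw [pow_succ, hpm]
    rw [sub_sub_cancel, e] at hb
    have hs := remainingProb_sub y (by omega : j < m + 1)
    have h1 := mul_le_mul_of_nonneg_left ih hp.1.le
    have h2 := mul_le_mul_of_nonneg_left hlog (mul_pos hθ hvp).le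
    have h3 := mul_le_mul_of_nonneg_left (hstep j (by omega)) hθ.le
    rw [entropyRate_eq hvp.le hv1] at h3
    have h4 : θ * (1 / θ - 1) = 1 - θ := by field_simp
    have h5 : θ * (-(v j - v j * Real.log (v j)) - (1 / θ - 1)) =
      -(θ * (v j - v j * Real.log (v j))) - (1 - θ) := by rw [← h4]; ring
    rw [h5] at h3
    linarith

/-- Compressing time by `1 - 2 ε` slows the descent by at most `2 ε (c + 1)`, as `entropyRate ≤ 1`.
The mean value theorem and uniform continuity make the discretization error at most `η`. -/
lemma exists_euler_slack {c ε η : ℝ} {H : ℝ → ℝ} (hε0 : 0 < ε) (hη : 0 < η) (hd : ∀ x, HasDerivAt H (-(c + entropyRate (H x))) x) :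
    ∃ N : ℕ, ∀ n ≥ N, 1 ≤ n → ∀ j < n,
      n * (H (ε + (1 - 2 * ε) * ((j + 1 : ℕ) / n)) - H (ε + (1 - 2 * ε) * (j / n))) ≤
        -entropyRate (H (ε + (1 - 2 * ε) * (j / n))) - c + 2 * ε * (c + 1) + η := by
  have hHc : Continuous H := continuous_iff_continuousAt.2 fun x => (hd x).continuousAt
  set V : ℝ → ℝ := fun t => H (ε + (1 - 2 * ε) * t) with hV
  have hVc : Continuous V := by fun_prop
  have hVd : ∀ t, HasDerivAt V (-(c + entropyRate (V t)) * (1 - 2 * ε)) t := fun t => by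
    refine (hd (ε + (1 - 2 * ε) * t)).comp t ?_
    simpa using ((hasDerivAt_id t).const_mul (1 - 2 * ε)).const_add ε
  have huc := isCompact_Icc.uniformContinuousOn_of_continuous
    (continuous_entropyRate.comp hVc).continuousOn (s := Icc (0 : ℝ) 1)
  obtain ⟨δ, hδ, hδη⟩ := Metric.uniformContinuousOn_iff.1 huc η hη
  obtain ⟨N, hN⟩ := exists_nat_gt (1 / δ)
  refine ⟨N, fun n hn hn1 j hj => ?_⟩
  have hnpos : (0 : ℝ) < n := by exact_mod_cast hn1
  have hlt : (j : ℝ) / n < ((j + 1 : ℕ) : ℝ) / n := by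
    gcongr; exact Nat.lt_succ_self j
  obtain ⟨ξ, hξ, hmv⟩ := exists_hasDerivAt_eq_slope V _ hlt hVc.continuousOn
    (fun t _ => hVd t)
  have hgap : ((j + 1 : ℕ) : ℝ) / n - j / n = 1 / n := by push_cast; ring
  rw [hgap, div_div_eq_mul_div, div_one] at hmv
  have hj0 : (0 : ℝ) ≤ j / n := by positivity
  have hj1 : ((j + 1 : ℕ) : ℝ) / n ≤ 1 := by
    rw [div_le_one hnpos]; exact_mod_cast hj
  have hdist : dist ξ ((j : ℝ) / n) < δ := by
    rw [Real.dist_eq, abs_of_pos (sub_pos.2 hξ.1)]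
    have h1 : (1 : ℝ) / n < δ := by
      rw [div_lt_iff₀ hnpos]
      have h2 : 1 / δ < n := hN.trans_le (by exact_mod_cast hn)
      rw [div_lt_iff₀ hδ] at h2
      linarith
    linarith [hξ.2]
  have hG := hδη ξ ⟨hj0.trans hξ.1.le, hξ.2.le.trans hj1⟩ _ ⟨hj0, hlt.le.trans hj1⟩ hdist
  rw [Real.dist_eq] at hG
  have hG' := (abs_lt.1 hG).1
  simp only [Function.comp] at hG'
  have hle1 := mul_le_mul_of_nonneg_left (entropyRate_le_one (V ξ)) (by linarith : 0 ≤ 2 * ε)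
  have hfin : (V (((j + 1 : ℕ) : ℝ) / n) - V (j / n)) * n ≤
      -entropyRate (V (j / n)) - c + 2 * ε * (c + 1) + η := by
    rw [← hmv]
    linarith
  simpa only [hV, mul_comm (n : ℝ)] using hfin

lemma eventually_notMem_iidFeasible {c : ℝ} (hc : 0 < c) {H : ℝ → ℝ}
    (hH : StrictAnti H) (h0 : H 0 = 1) (h1 : H 1 = 0)
    (hd : ∀ x, HasDerivAt H (-(c + entropyRate (H x))) x) {θ : ℝ} (hθ : 1 / (1 + c) < θ) :
    ∀ᶠ n in atTop, θ ∉ iidFeasible 1 n := by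
  have hθ0 : 0 < θ := lt_trans (by positivity) hθ
  have hgap : 0 < c - (1 / θ - 1) := by
    have := (one_div_lt hθ0 (by positivity)).2 hθ
    linarith
  set κ := c - (1 / θ - 1) with hκ
  -- The gap `κ` between the constants pays `κ / 2` for the compression and `κ / 2` for the
  -- discretization; `ε > 0` keeps the sampled values strictly between `0` and `1`.
  set ε := min (1 / 4) (κ / (4 * (c + 1))) with hεdef
  have hε0 : 0 < ε := lt_min (by norm_num) (by positivity)
  have hε4 : ε ≤ 1 / 4 := min_le_left _ _
  have hεκ : 2 * ε * (c + 1) ≤ κ / 2 := by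
    have h2 := (le_div_iff₀ (by positivity)).1 (min_le_right (1 / 4) (κ / (4 * (c + 1))))
    rw [← hεdef] at h2
    linarith
  obtain ⟨N, hN⟩ := exists_euler_slack hε0 (half_pos hgap) hd
  filter_upwards [eventually_ge_atTop (max N 2)] with n hn hmem
  have hnN : N ≤ n := (le_max_left _ _).trans hn
  have hn2 : 2 ≤ n := (le_max_right _ _).trans hn
  obtain ⟨m, rfl⟩ : ∃ m, n = m + 1 := ⟨n - 1, by omega⟩
  obtain ⟨y, hy, hq⟩ := mem_iidFeasible_one_iff.1 hmem
  have hrange : ∀ j ≤ m + 1, ε + (1 - 2 * ε) * ((j : ℝ) / (m + 1 : ℕ)) ∈ Ioo (0 : ℝ) 1 :=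
    fun j hj => by
    have h2 : (0 : ℝ) ≤ j / (m + 1 : ℕ) := by positivity
    have h3 : (j : ℝ) / (m + 1 : ℕ) ≤ 1 := by
      rw [div_le_one (by positivity)]; exact_mod_cast hj
    constructor <;> nlinarith
  have hvpos : ∀ j ≤ m + 1, 0 < H (ε + (1 - 2 * ε) * ((j : ℝ) / (m + 1 : ℕ))) :=
    fun j hj => h1 ▸ hH (hrange j hj).2
  have hvlt : ∀ j ≤ m + 1, H (ε + (1 - 2 * ε) * ((j : ℝ) / (m + 1 : ℕ))) < 1 :=
    fun j hj => (hH (hrange j hj).1).trans_eq h0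
  have key := le_remainingProb (by omega : m ≠ 0) hθ0 hq (fun i hi => freeProb_le_one hy hi)
    (v := fun j => H (ε + (1 - 2 * ε) * ((j : ℝ) / (m + 1 : ℕ)))) (hvlt 0 (by omega))
    (fun j hj => ⟨hvpos j hj, (hvlt j hj).le⟩)
    (fun j hj => by
      have h2 := hN (m + 1) hnN (by omega) j hj
      rw [show ((m : ℝ) + 1) = (m + 1 : ℕ) by push_cast; rfl]
      linarith) (m + 1) le_rfl
  have hzero : remainingProb (m + 1) y (m + 1) = 0 := by simp [remainingProb]
  rw [hzero] at key
  have h2 := hvpos (m + 1) le_rfl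
  have : 0 < θ * (((m : ℝ) + 1) * H (ε + (1 - 2 * ε) * (((m + 1 : ℕ) : ℝ) / (m + 1 : ℕ)))) := by
    positivity
  linarith

theorem mainTheorem7 :
    (∀ n : ℕ, 1 ≤ n → IsGreatest (iidFeasible 1 n) (iidLP 1 n)) ∧
    ∃ θ : ℝ, IsLimitConstant θ ∧ (∀ θ' : ℝ, IsLimitConstant θ' → θ' = θ) ∧
      0.745 < θ ∧ θ < 0.746 ∧
      IsGLB {v : ℝ | ∃ n : ℕ, 1 ≤ n ∧ v = iidLP 1 n} θ ∧
      Tendsto (fun n : ℕ => iidLP 1 n) atTop (𝓝 θ) := by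
  refine ⟨fun n hn => isGreatest_iidLP hn, ?_⟩
  obtain ⟨c, hc1, hc2, hc⟩ := exists_descentTime_eq_one
  have hc0 : 0 < c := lt_trans (by norm_num) hc1
  obtain ⟨H, hH, h0, h1, hd⟩ := exists_descent hc0 hc
  have hθ := isLimitConstant_of_descent hc0 hH h0 h1 hd
  have hlow : ∀ n : ℕ, 1 ≤ n → 1 / (1 + c) ≤ iidLP 1 n := fun n hn =>
    (isGreatest_iidLP hn).2
      (mem_iidFeasible_of_descent hc0 (hc2.le.trans (by norm_num)) hH h0 h1 hd hn)
  have hlim : Tendsto (fun n : ℕ => iidLP 1 n) atTop (𝓝 (1 / (1 + c))) := by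
    refine tendsto_order.2 ⟨fun a ha => ?_, fun b hb => ?_⟩
    · filter_upwards [eventually_ge_atTop 1] with n hn
      exact ha.trans_le (hlow n hn)
    · filter_upwards [eventually_ge_atTop 1,
        eventually_notMem_iidFeasible hc0 hH h0 h1 hd hb] with n hn hnot
      by_contra! hle
      exact hnot (mem_iidFeasible_of_le (isGreatest_iidLP hn).1 hle)
  refine ⟨1 / (1 + c), hθ, fun θ' h' => le_antisymm (h'.le hθ) (hθ.le h'), ?_, ?_, ⟨?_, ?_⟩, hlim⟩
  · rw [lt_div_iff₀ (by positivity)]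
    linarith
  · rw [div_lt_iff₀ (by positivity)]
    linarith
  · rintro v ⟨n, hn, rfl⟩
    exact hlow n hn
  · intro b hb
    refine ge_of_tendsto hlim ?_
    filter_upwards [eventually_ge_atTop 1] with n hn
    exact hb ⟨n, hn, rfl⟩
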